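/- Let $\mathbb{R}_{\max}=\mathbb{R}\cup\{-\infty\}$ and write $(A\otimes B)_{ij}=\max_l(A_{il}+B_{lj})$, $(A\otimes u)_i=\max_j(A_{ij}+u_j)$. The graph of $A\in\mathbb{R}_{\max}^{k\times k}$ has nodes $1,\dots,k$ and an arc from $i$ to $j$ with weight $A_{ji}$ iff $A_{ji}\neq-\infty$; $A$ is irreducible if any node can be reached from any node by a path of length at least $1$ in this graph. A circuit is critical if its average weight (sum of its arc weights divided by its length) is maximal among all circuits; the critical graph consists of the nodes and arcs lying on critical circuits. The cyclicity of a graph is the least common multiple, over its maximal strongly connected subgraphs (s.c.s.), of the greatest common divisor of the lengths of the circuits in that subgraph. A matrix is scs1-cyc1 if it is irreducible and its critical graph has a unique s.c.s. and cyclicity $1$. Let $\pi$ be the projection of $\mathbb{R}^k$ onto $\mathbb{PR}^k$, the quotient of $\mathbb{R}^k$ by the relation $u\simeq v\iff\exists a\in\mathbb{R}\ \forall i\; u_i=a+v_i$. Let $(\Omega,\mathcal{F},P)$ be a probability space with a bimeasurable bijection $\theta$ of $\Omega$ for which $P$ is invariant and ergodic. Let $(A_l)_{l\in\mathcal{L}}$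 be a finite or countable collection of irreducible $k\times k$ matrices over $\mathbb{R}_{\max}$, and let $A(n)=A(0)\circ\theta^n$, $n\ge 0$, be an i.i.d. sequence of random matrices with $P(A(0)=A_l)>0$ for every $l\in\mathcal{L}$ and $P(A(0)\in\{A_l:l\in\mathcal{L}\})=1$. For a random vector $x_0$ in $\mathbb{R}^k$ (possibly deterministic) let $x(0)=x_0$, $x(n+1)=A(n)\otimes x(n)$. Theorem. Suppose that $\{A(n)\}$ has a scs1-cyc1 pattern, i.e. there are $N\ge 1$ and $u_0,\dots,u_{N-1}\in\mathcal{L}$ such that $C=A_{u_{N-1}}\otimes\cdots\otimes A_{u_0}$ is scs1-cyc1 and $P(A(N-1)\otimes\cdots\otimes A(0)=C)>0$. Then there is a random variable $Z:\Omega\to\mathbb{PR}^k$ such that: 1. $\{Z\circ\theta^n\}$ is a stationary regime, i.e. $Z\circ\theta=\pi(A(0)\otimes\pi^{-1}(Z))$ almost surely, and it is the only one: every random variable $Z'$ with $Z'\circ\theta=\pi(A(0)\otimes\pi^{-1}(Z'))$ a.s. equals $Z$ a.s. 2. For every initial condition $x_0$, $\{\pi(x(n))\}$ converges with strong coupling to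 $\{Z\circ\theta^n\}$, i.e. $\nu=\min\{n\ge 0:\ \pi(x(n+l))\circ\theta^{-(n+l)}=Z\ \ \forall l\ge 0\}$ is almost surely finite. 3. For every initial condition $x_0$, $\pi(x(n))$ converges in total variation to the law of $Z$: $\sup_B|P(\pi(x(n))\in B)-P(Z\in B)|\to 0$ as $n\to\infty$, the supremum being over the measurable $B\subset\mathbb{PR}^k$. -/

import Mathlib

open MeasureTheory ProbabilityTheory Filter Topology

/-- The Borel `σ`-algebra of `ℝ ∪ {-∞}`: a set is measurable iff its real part is Borel. -/
instance instMeasurableSpaceRmax : MeasurableSpace (WithBot ℝ) :=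
  MeasurableSpace.map (fun r : ℝ => (r : WithBot ℝ)) inferInstance

namespace MaxPlus

/-! ### The (max,+) semiring: `⊕` is `⊔`, `⊗` is `+`, the zero `ε` is `⊥`, the unit `e` is `0` -/

/-- Square matrices of size `k` over `ℝ_max = ℝ ∪ {-∞}`. -/
abbrev Mat (k : ℕ) : Type := Fin k → Fin k → WithBot ℝ

/-- The (max,+) product `(A ⊗ B)_{ij} = max_l (A_{il} + B_{lj})`. -/
noncomputable def mul {k : ℕ} (A B : Mat k) : Mat k :=
  fun i j => Finset.univ.sup fun l => A i l + B l j

/-- The identity matrix: `e = 0` on the diagonal, `ε = -∞` elsewhere. -/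
noncomputable def one (k : ℕ) : Mat k := fun i j => if i = j then 0 else ⊥

/-- The product `U (N-1) ⊗ ⋯ ⊗ U 1 ⊗ U 0`. -/
noncomputable def prod {k : ℕ} (U : ℕ → Mat k) : ℕ → Mat k
  | 0 => one k
  | N + 1 => mul (U N) (prod U N)

/-- The power `A^{⊗ n}`. -/
noncomputable def pow {k : ℕ} (A : Mat k) (n : ℕ) : Mat k := prod (fun _ => A) n

/-- `A` is irreducible: its graph is strongly connected, any two nodes being joined by a path of
positive length. (Requiring positive length only matters in size one, where it excludes the
matrix `(-∞)`, which does not map `ℝ` to `ℝ`.) -/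
def Irreducible {k : ℕ} (A : Mat k) : Prop :=
  ∀ i j, ∃ n, 1 ≤ n ∧ pow A n i j ≠ ⊥

/-- The product `A ⊗ u` of a matrix and a real vector, `(A ⊗ u)_i = max_j (A_{ij} + u_j)`,
for matrices whose rows are all different from `ε` (see `coe_act`). -/
noncomputable def act {k : ℕ} (A : Mat k) (u : Fin k → ℝ) : Fin k → ℝ :=
  fun i => (Finset.univ.sup fun j => A i j + (u j : WithBot ℝ)).unbotD 0

/-- An irreducible matrix has no row equal to `ε`. -/
theorem Irreducible.exists_ne_bot {k : ℕ} {A : Mat k} (hA : Irreducible A) (i : Fin k) :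
    ∃ j, A i j ≠ ⊥ := by
  obtain ⟨n, hn, h⟩ := hA i i
  obtain ⟨m, rfl⟩ : ∃ m, n = m + 1 := ⟨n - 1, by omega⟩
  by_contra! hc
  apply h
  simp [pow, prod, mul, hc]

/-- For irreducible matrices the default value in `act` is never used. -/
theorem coe_act {k : ℕ} {A : Mat k} (hA : Irreducible A) (u : Fin k → ℝ) (i : Fin k) :
    ((act A u i : ℝ) : WithBot ℝ) = Finset.univ.sup fun j => A i j + (u j : WithBot ℝ) := by
  obtain ⟨j, hj⟩ := hA.exists_ne_bot i
  have h1 : A i j + (u j : WithBot ℝ) ≠ ⊥ := by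
    simp [WithBot.add_eq_bot, hj]
  have h2 : (Finset.univ.sup fun j => A i j + (u j : WithBot ℝ)) ≠ ⊥ := by
    intro h
    rw [Finset.sup_eq_bot_iff] at h
    exact h1 (h j (Finset.mem_univ j))
  obtain ⟨r, hr⟩ := WithBot.ne_bot_iff_exists.1 h2
  simp [act, ← hr]

/-! ### The projective space -/

/-- The parallelism relation on `ℝ^k`: `u = a ⊗ v` for some real `a`. -/
def projSetoid (k : ℕ) : Setoid (Fin k → ℝ) where
  r u v := ∃ a : ℝ, ∀ i, u i = a + v i
  iseqv :=
    { refl := fun u => ⟨0, fun i => by simp⟩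
      symm := fun {u v} h => by
        obtain ⟨a, ha⟩ := h
        exact ⟨-a, fun i => by rw [ha i]; ring⟩
      trans := fun {u v w} h h' => by
        obtain ⟨a, ha⟩ := h
        obtain ⟨b, hb⟩ := h'
        exact ⟨a + b, fun i => by rw [ha i, hb i]; ring⟩ }

/-- The projective space `ℙℝ^k`, with the quotient `σ`-algebra. -/
abbrev Proj (k : ℕ) : Type := Quotient (projSetoid k)

/-- The canonical projection `π : ℝ^k → ℙℝ^k`. -/
def proj {k : ℕ} (u : Fin k → ℝ) : Proj k := Quotient.mk (projSetoid k) u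

/-! ### Strongly connected subgraphs and cyclicity of a directed graph -/

section Graph

variable {V : Type*}

/-- `S` is the node set of a maximal strongly connected subgraph (s.c.s.) of `G`: a class of
mutually reachable nodes. -/
def IsScs (G : Digraph V) (S : Set V) : Prop :=
  ∃ v, S = {w | Relation.ReflTransGen G.Adj v w ∧ Relation.ReflTransGen G.Adj w v}

/-- The lengths of the circuits of `G` all of whose nodes lie in `S`. -/
def circuitLengths (G : Digraph V) (S : Set V) : Set ℕ :=
  {n | 0 < n ∧ ∃ t : ℕ → V, t n = t 0 ∧ (∀ m < n, G.Adj (t m) (t (m + 1))) ∧ ∀ m ≤ n, t m ∈ S}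

/-- The greatest common divisor of the lengths of the circuits inside `S`
(it is `0` if there is no circuit). -/
noncomputable def scsCyclicity (G : Digraph V) (S : Set V) : ℕ :=
  sSup {d | ∀ n ∈ circuitLengths G S, d ∣ n}

/-- The cyclicity of a graph: the least common multiple of the cyclicities of its s.c.s. -/
noncomputable def graphCyclicity (G : Digraph V) : ℕ :=
  sInf {m | 0 < m ∧ ∀ S, IsScs G S → scsCyclicity G S ∣ m}

end Graph

/-! ### The critical graph of a matrix -/

/-- `t 0, t 1, …, t n = t 0` is a circuit of the graph of `A`, which has an arc from `i` to `j`,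
of valuation `A_{ji}`, iff `A_{ji} ≠ ε`. -/
def IsCircuit {k : ℕ} (A : Mat k) (n : ℕ) (t : ℕ → Fin k) : Prop :=
  0 < n ∧ t n = t 0 ∧ ∀ m < n, A (t (m + 1)) (t m) ≠ ⊥

/-- The average weight of the circuit `t 0, …, t n = t 0`. -/
noncomputable def avgWeight {k : ℕ} (A : Mat k) (n : ℕ) (t : ℕ → Fin k) : ℝ :=
  (∑ m ∈ Finset.range n, (A (t (m + 1)) (t m)).unbotD 0) / n

/-- A circuit is critical if its average weight is maximal among all circuits of `A`. -/
def IsCriticalCircuit {k : ℕ} (A : Mat k) (n : ℕ) (t : ℕ → Fin k) : Prop :=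
  IsCircuit A n t ∧ ∀ n' t', IsCircuit A n' t' → avgWeight A n' t' ≤ avgWeight A n t

/-- `i` is a node of some critical circuit. -/
def IsCriticalNode {k : ℕ} (A : Mat k) (i : Fin k) : Prop :=
  ∃ n t, IsCriticalCircuit A n t ∧ ∃ m < n, t m = i

/-- The critical graph: the nodes and arcs that belong to critical circuits. -/
def criticalGraph {k : ℕ} (A : Mat k) : Digraph {i : Fin k // IsCriticalNode A i} where
  Adj i j := ∃ n t, IsCriticalCircuit A n t ∧ ∃ m < n, t m = i ∧ t (m + 1) = j

/-- A **scs1-cyc1** matrix: an irreducible matrix whose critical graph has a unique strongly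
connected component and has cyclicity one. -/
def IsScs1Cyc1 {k : ℕ} (A : Mat k) : Prop :=
  Irreducible A ∧ (∃! S, IsScs (criticalGraph A) S) ∧ graphCyclicity (criticalGraph A) = 1

/-! ### The stochastic recursive sequence -/

section Stochastic

variable {Ω : Type*} [MeasurableSpace Ω]

/-- The random matrix `A(n) = A(0) ∘ θ^n`. -/
def matSeq {k : ℕ} (θ : Ω ≃ᵐ Ω) (A : Ω → Mat k) (n : ℕ) (ω : Ω) : Mat k := A (θ^[n] ω)

/-- The sequence `x(n+1) = A(n) ⊗ x(n)`, with (possibly random) initial condition `x(0) = x₀`. -/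
noncomputable def state {k : ℕ} (θ : Ω ≃ᵐ Ω) (A : Ω → Mat k) (x₀ : Ω → Fin k → ℝ) :
    ℕ → Ω → Fin k → ℝ
  | 0, ω => x₀ ω
  | n + 1, ω => act (matSeq θ A n ω) (state θ A x₀ n ω)

/-- `C` is a pattern of `{A(n)}`: a finite product of matrices of the collection `M` which
`A(N-1) ⊗ ⋯ ⊗ A(0)` equals with positive probability. -/
def IsPattern {k : ℕ} {L : Type*} (P : Measure Ω) (θ : Ω ≃ᵐ Ω) (M : L → Mat k) (A : Ω → Mat k)
    (C : Mat k) : Prop :=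
  ∃ N, 1 ≤ N ∧ (∃ u : ℕ → L, C = prod (fun n => M (u n)) N) ∧
    0 < P {ω | prod (fun n => matSeq θ A n ω) N = C}

/-- `{Z ∘ θ^n}` is a stationary regime of `{π(x(n))}`: `Z` is a random variable with
`Z ∘ θ = π(A(0) ⊗ π⁻¹(Z))` almost surely. -/
def IsStationaryRegime {k : ℕ} (P : Measure Ω) (θ : Ω ≃ᵐ Ω) (A : Ω → Mat k) (Z : Ω → Proj k) :
    Prop :=
  Measurable Z ∧ ∀ᵐ ω ∂P, ∀ u : Fin k → ℝ, proj u = Z ω → Z (θ ω) = proj (act (A ω) u)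

/-- Strong coupling convergence in finite time of `X` to `{Y ∘ θ^n}`: almost surely there is a
finite `n` with `X_{n+l} ∘ θ^{-(n+l)} = Y` for all `l ≥ 0`. -/
def StrongCoupling {E : Type*} (P : Measure Ω) (θ : Ω ≃ᵐ Ω) (X : ℕ → Ω → E) (Y : Ω → E) : Prop :=
  ∀ᵐ ω ∂P, ∃ n, ∀ l, X (n + l) (θ.symm^[n + l] ω) = Y ω

/-- Convergence in total variation of `X_n` to (the law of) `Y`. -/
def TendstoTV {E : Type*} [MeasurableSpace E] (P : Measure Ω) (X : ℕ → Ω → E) (Y : Ω → E) : Prop :=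
  Tendsto (fun n => ⨆ B : {B : Set E // MeasurableSet B},
    |P.real {ω | X n ω ∈ B.1} - P.real {ω | Y ω ∈ B.1}|) atTop (𝓝 0)

end Stochastic

end MaxPlus

namespace MaxPlus

variable {k : ℕ}

/-! ### Walks and their weights -/

/-- There is a walk of length `n` and weight `x` from `i` to `j` in the graph of `A`. -/
def HasWalk (A : Mat k) : ℕ → ℝ → Fin k → Fin k → Prop
  | 0, x, i, j => x = 0 ∧ i = j
  | n + 1, x, i, j => ∃ l y w, HasWalk A n y i l ∧ A j l = ((w : ℝ) : WithBot ℝ) ∧ x = y + w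

theorem HasWalk.refl (A : Mat k) (i : Fin k) : HasWalk A 0 0 i i := ⟨rfl, rfl⟩

theorem HasWalk.snoc {A : Mat k} {n : ℕ} {y w : ℝ} {i l j : Fin k} (h : HasWalk A n y i l)
    (hw : A j l = (w : WithBot ℝ)) : HasWalk A (n + 1) (y + w) i j :=
  ⟨l, y, w, h, hw, rfl⟩

theorem HasWalk.trans {A : Mat k} {n m : ℕ} {x y : ℝ} {i j l : Fin k} (h : HasWalk A n x i j)
    (h' : HasWalk A m y j l) : HasWalk A (n + m) (x + y) i l := by
  induction m generalizing y l with
  | zero => obtain ⟨rfl, rfl⟩ := h'; simpa using h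
  | succ m ih =>
    obtain ⟨s, z, w, hz, hw, rfl⟩ := h'
    rw [← add_assoc, ← add_assoc]
    exact (ih hz).snoc hw

theorem HasWalk.split {A : Mat k} {n m : ℕ} {x : ℝ} {i l : Fin k} (h : HasWalk A (n + m) x i l) :
    ∃ j y z, HasWalk A n y i j ∧ HasWalk A m z j l ∧ x = y + z := by
  induction m generalizing x l with
  | zero => exact ⟨l, x, 0, h, .refl A l, by simp⟩
  | succ m ih =>
    obtain ⟨s, y, w, hy, hw, rfl⟩ := h
    obtain ⟨j, y', z, h1, h2, rfl⟩ := ih hy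
    exact ⟨j, y', z + w, h1, h2.snoc hw, by ring⟩

theorem hasWalk_of_fun {A : Mat k} {t : ℕ → Fin k} {a n : ℕ}
    (ht : ∀ m < n, A (t (a + m + 1)) (t (a + m)) ≠ ⊥) :
    HasWalk A n (∑ m ∈ Finset.range n, (A (t (a + m + 1)) (t (a + m))).unbotD 0)
      (t a) (t (a + n)) := by
  induction n with
  | zero => simpa using HasWalk.refl A (t a)
  | succ n ih =>
    rw [Finset.sum_range_succ]
    refine (ih fun m hm => ht m (by omega)).snoc ?_
    obtain ⟨r, hr⟩ := WithBot.ne_bot_iff_exists.1 (ht n (by omega))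
    rw [← add_assoc, ← hr, WithBot.unbotD_coe]

theorem HasWalk.exists_fun {A : Mat k} {n : ℕ} {x : ℝ} {i j : Fin k} (h : HasWalk A n x i j) :
    ∃ t : ℕ → Fin k, t 0 = i ∧ t n = j ∧ (∀ m < n, A (t (m + 1)) (t m) ≠ ⊥) ∧
      x = ∑ m ∈ Finset.range n, (A (t (m + 1)) (t m)).unbotD 0 := by
  induction n generalizing x j with
  | zero => obtain ⟨rfl, rfl⟩ := h; exact ⟨fun _ => i, by simp⟩
  | succ n ih =>
    obtain ⟨l, y, w, hy, hw, rfl⟩ := h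
    obtain ⟨t, h0, hn, ht, rfl⟩ := ih hy
    have key : ∀ m ≤ n, Function.update t (n + 1) j m = t m := fun m hm =>
      Function.update_of_ne (by omega) _ _
    refine ⟨Function.update t (n + 1) j, by rw [key 0 (by omega), h0], by simp, ?_, ?_⟩
    · intro m hm
      rcases Nat.lt_succ_iff_lt_or_eq.1 hm with hm | rfl
      · rw [key m (by omega), key (m + 1) (by omega)]
        exact ht m hm
      · rw [key m le_rfl, Function.update_self, hn, hw]
        exact WithBot.coe_ne_bot
    · rw [Finset.sum_range_succ, key n le_rfl, Function.update_self, hn, hw, WithBot.unbotD_coe]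
      congr 1
      refine Finset.sum_congr rfl fun m hm => ?_
      rw [Finset.mem_range] at hm
      rw [key m (by omega), key (m + 1) (by omega)]

/-- A walk with at least `k` arcs contains a circuit. -/
theorem HasWalk.exists_circuit {A : Mat k} {n : ℕ} {x : ℝ} {i j : Fin k} (h : HasWalk A n x i j)
    (hn : k ≤ n) : ∃ s n₁ n₂ n₃ x₁ x₂ x₃, HasWalk A n₁ x₁ i s ∧ HasWalk A n₂ x₂ s s ∧
      HasWalk A n₃ x₃ s j ∧ 0 < n₂ ∧ n = n₁ + n₂ + n₃ ∧ x = x₁ + x₂ + x₃ := by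
  obtain ⟨t, h0, hn', ht, rfl⟩ := h.exists_fun
  obtain ⟨a, b, hab, hb, hs⟩ : ∃ a b, a < b ∧ b ≤ n ∧ t a = t b := by
    obtain ⟨a, b, hne, he⟩ := Fintype.exists_ne_map_eq_of_card_lt
      (fun m : Fin (n + 1) => t m) (by simpa using Nat.lt_succ_of_le hn)
    rcases lt_or_gt_of_ne hne with hlt | hlt
    · exact ⟨a, b, hlt, by omega, he⟩
    · exact ⟨b, a, hlt, by omega, he.symm⟩
  have w1 := hasWalk_of_fun (A := A) (t := t) (a := 0) (n := a)
    (fun m hm => by simpa using ht m (by omega))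
  have w2 := hasWalk_of_fun (A := A) (t := t) (a := a) (n := b - a)
    (fun m hm => by simpa using ht (a + m) (by omega))
  have w3 := hasWalk_of_fun (A := A) (t := t) (a := b) (n := n - b)
    (fun m hm => by simpa using ht (b + m) (by omega))
  rw [h0, zero_add] at w1
  rw [Nat.add_sub_cancel' hab.le, ← hs] at w2
  rw [Nat.add_sub_cancel' hb, hn', ← hs] at w3
  refine ⟨_, _, _, _, _, _, _, w1, w2, w3, by omega, by omega, ?_⟩
  obtain ⟨c, rfl⟩ := Nat.exists_eq_add_of_le hab.le
  obtain ⟨d, rfl⟩ := Nat.exists_eq_add_of_le hb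
  rw [Nat.add_sub_cancel_left, Nat.add_sub_cancel_left]
  simp [Finset.sum_range_add, add_assoc]

theorem finite_weights (A : Mat k) (n : ℕ) (i j : Fin k) : {x | HasWalk A n x i j}.Finite := by
  induction n generalizing j with
  | zero => exact (Set.finite_singleton 0).subset fun x hx => hx.1
  | succ n ih =>
    refine (Set.finite_iUnion fun l =>
      (ih l).image fun y => y + (A j l).unbotD 0).subset fun x hx => ?_
    obtain ⟨l, y, w, hy, hw, rfl⟩ := hx
    exact Set.mem_iUnion.2 ⟨l, y, hy, by simp [hw]⟩

/-- If all circuits have nonpositive weight, the walks between two nodes have a heaviest one. -/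
theorem exists_max_walk {A : Mat k} (hA : ∀ n x i, HasWalk A n x i i → x ≤ 0) {i j : Fin k}
    (h : ∃ n x, HasWalk A n x i j) :
    ∃ a n, HasWalk A n a i j ∧ ∀ m x, HasWalk A m x i j → x ≤ a := by
  -- Deleting circuits never lowers the weight, so walks with fewer than `k` arcs dominate, and
  -- these have only finitely many weights.
  have dom : ∀ n x, HasWalk A n x i j → ∃ m < k, ∃ y, HasWalk A m y i j ∧ x ≤ y := by
    intro n
    induction n using Nat.strong_induction_on with
    | _ n ih =>
      intro x hx
      rcases lt_or_ge n k with hn | hn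
      · exact ⟨n, hn, x, hx, le_rfl⟩
      · obtain ⟨s, n₁, n₂, n₃, x₁, x₂, x₃, h1, h2, h3, hpos, rfl, rfl⟩ := hx.exists_circuit hn
        obtain ⟨m, hm, y, hy, hle⟩ := ih (n₁ + n₃) (by omega) _ (h1.trans h3)
        exact ⟨m, hm, y, hy, by linarith [hA _ _ _ h2]⟩
  have fin : (⋃ m ∈ Finset.range k, {x | HasWalk A m x i j}).Finite :=
    Set.Finite.biUnion (Finset.finite_toSet _) fun m _ => finite_weights A m i j
  obtain ⟨n, x, hx⟩ := h
  obtain ⟨m, hm, y, hy, -⟩ := dom n x hx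
  obtain ⟨a, ha, hmax⟩ := Set.exists_max_image _ id fin
    ⟨y, by simpa using ⟨m, hm, hy⟩⟩
  simp only [Finset.mem_range, Set.mem_iUnion, Set.mem_ofPred_eq, exists_prop] at ha
  obtain ⟨p, -, hp⟩ := ha
  refine ⟨a, p, hp, fun q z hz => ?_⟩
  obtain ⟨m', hm', y', hy', hle⟩ := dom q z hz
  exact hle.trans (hmax y' (by simpa using ⟨m', hm', hy'⟩))

theorem exists_hasWalk_of_pow_ne_bot {A : Mat k} {n : ℕ} {i j : Fin k} (h : pow A n i j ≠ ⊥) :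
    ∃ x, HasWalk A n x j i := by
  induction n generalizing i with
  | zero =>
    by_cases hij : i = j
    · exact ⟨0, rfl, hij.symm⟩
    · simp [pow, prod, one, hij] at h
  | succ n ih =>
    have : ∃ l, A i l + pow A n l j ≠ ⊥ := by
      by_contra! hc
      exact h (by simpa [pow, prod, mul] using hc)
    obtain ⟨l, hl⟩ := this
    rw [Ne, WithBot.add_eq_bot, not_or] at hl
    obtain ⟨x, hx⟩ := ih hl.2
    obtain ⟨w, hw⟩ := WithBot.ne_bot_iff_exists.1 hl.1
    exact ⟨_, hx.snoc hw.symm⟩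

theorem Irreducible.exists_hasWalk {A : Mat k} (hA : Irreducible A) (i j : Fin k) :
    ∃ n x, HasWalk A n x i j := by
  obtain ⟨n, -, hn⟩ := hA j i
  exact ⟨n, exists_hasWalk_of_pow_ne_bot hn⟩

/-! ### The action of a matrix without `ε` rows -/

/-- Products of irreducible matrices may fail to be irreducible, whereas having no ε row is stable
under products; the rest of the proof uses this weaker condition. -/
theorem coe_act_of_row {A : Mat k} {i : Fin k} (hA : ∃ j, A i j ≠ ⊥) (u : Fin k → ℝ) :
    ((act A u i : ℝ) : WithBot ℝ) = Finset.univ.sup fun j => A i j + (u j : WithBot ℝ) := by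
  obtain ⟨j, hj⟩ := hA
  have h2 : (Finset.univ.sup fun j => A i j + (u j : WithBot ℝ)) ≠ ⊥ := by
    intro h
    rw [Finset.sup_eq_bot_iff] at h
    have h1 := h j (Finset.mem_univ j)
    simp [WithBot.add_eq_bot, hj] at h1
  obtain ⟨r, hr⟩ := WithBot.ne_bot_iff_exists.1 h2
  simp [act, ← hr]

theorem le_act {A : Mat k} {i j : Fin k} {w : ℝ} (hw : A i j = (w : WithBot ℝ)) (u : Fin k → ℝ) :
    w + u j ≤ act A u i := by
  rw [← WithBot.coe_le_coe, coe_act_of_row ⟨j, by simp [hw]⟩, WithBot.coe_add, ← hw]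
  exact Finset.le_sup (f := fun j => A i j + (u j : WithBot ℝ)) (Finset.mem_univ j)

theorem exists_act_eq {A : Mat k} {i : Fin k} (hA : ∃ j, A i j ≠ ⊥) (u : Fin k → ℝ) :
    ∃ j w, A i j = ((w : ℝ) : WithBot ℝ) ∧ act A u i = w + u j := by
  have h := coe_act_of_row hA u
  obtain ⟨j₀, -⟩ := hA
  obtain ⟨j, -, hj⟩ := Finset.exists_mem_eq_sup Finset.univ ⟨j₀, Finset.mem_univ _⟩
    (fun j => A i j + (u j : WithBot ℝ))
  rw [hj] at h
  have hb : A i j ≠ ⊥ := by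
    intro hb
    simp [hb] at h
  obtain ⟨w, hw⟩ := WithBot.ne_bot_iff_exists.1 hb
  refine ⟨j, w, hw.symm, ?_⟩
  rw [← hw] at h
  exact_mod_cast h

theorem act_eq_of {A : Mat k} {u : Fin k → ℝ} {i : Fin k} {y : ℝ}
    (h : ∃ j w, A i j = ((w : ℝ) : WithBot ℝ) ∧ y = w + u j)
    (h' : ∀ j (w : ℝ), A i j = (w : WithBot ℝ) → w + u j ≤ y) : act A u i = y := by
  obtain ⟨j, w, hw, rfl⟩ := h
  obtain ⟨j', w', hw', he⟩ := exists_act_eq (A := A) (i := i) ⟨j, by simp [hw]⟩ u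
  exact le_antisymm (he ▸ h' j' w' hw') (le_act hw u)

theorem act_const_add {A : Mat k} (hA : ∀ i, ∃ j, A i j ≠ ⊥) {u v : Fin k → ℝ} {a : ℝ}
    (h : ∀ i, u i = a + v i) (i : Fin k) : act A u i = a + act A v i := by
  obtain ⟨j, w, hw, he⟩ := exists_act_eq (hA i) v
  refine act_eq_of ⟨j, w, hw, by rw [he, h]; ring⟩ fun j w hw => ?_
  rw [h]
  linarith [le_act hw v]

theorem proj_eq_iff {u v : Fin k → ℝ} : proj u = proj v ↔ ∃ a : ℝ, ∀ i, u i = a + v i :=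
  Quotient.eq

theorem proj_act_congr {A : Mat k} (hA : ∀ i, ∃ j, A i j ≠ ⊥) {u v : Fin k → ℝ}
    (h : proj u = proj v) : proj (act A u) = proj (act A v) := by
  obtain ⟨a, ha⟩ := proj_eq_iff.1 h
  exact proj_eq_iff.2 ⟨a, act_const_add hA ha⟩

theorem act_one (u : Fin k → ℝ) : act (one k) u = u := by
  funext i
  refine act_eq_of ⟨i, 0, by simp [one], by simp⟩ fun j w hw => ?_
  by_cases hij : i = j
  · subst hij
    simp only [one, if_true] at hw
    have : (0 : ℝ) = w := by exact_mod_cast hw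
    simp [← this]
  · simp [one, hij] at hw

theorem exists_mul_eq {A B : Mat k} {i j : Fin k} {w : ℝ} (h : mul A B i j = (w : WithBot ℝ)) :
    ∃ l a b, A i l = ((a : ℝ) : WithBot ℝ) ∧ B l j = ((b : ℝ) : WithBot ℝ) ∧ w = a + b := by
  obtain ⟨l, -, hl⟩ := Finset.exists_mem_eq_sup Finset.univ ⟨i, Finset.mem_univ _⟩
    (fun l => A i l + B l j)
  have h' : A i l + B l j = (w : WithBot ℝ) := hl.symm.trans h
  have hb : A i l + B l j ≠ ⊥ := by simp [h']
  rw [Ne, WithBot.add_eq_bot, not_or] at hb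
  obtain ⟨a, ha⟩ := WithBot.ne_bot_iff_exists.1 hb.1
  obtain ⟨b, hb⟩ := WithBot.ne_bot_iff_exists.1 hb.2
  refine ⟨l, a, b, ha.symm, hb.symm, ?_⟩
  rw [← ha, ← hb] at h'
  exact_mod_cast h'.symm

theorem le_mul_apply (A B : Mat k) (i l j : Fin k) : A i l + B l j ≤ mul A B i j :=
  Finset.le_sup (f := fun l => A i l + B l j) (Finset.mem_univ l)

/-- An ε row of `B` would feed the default value 0, instead of -∞, into the action of `A`; the row
conditions rule this out. -/
theorem act_mul {A B : Mat k} (hA : ∀ i, ∃ j, A i j ≠ ⊥) (hB : ∀ i, ∃ j, B i j ≠ ⊥)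
    (u : Fin k → ℝ) : act (mul A B) u = act A (act B u) := by
  have le : ∀ i j (w : ℝ), mul A B i j = (w : WithBot ℝ) → w + u j ≤ act A (act B u) i := by
    intro i j w hw
    obtain ⟨l, a, b, ha, hb, rfl⟩ := exists_mul_eq hw
    linarith [le_act ha (act B u), le_act hb u]
  funext i
  refine act_eq_of ?_ (le i)
  obtain ⟨l, a, ha, he⟩ := exists_act_eq (hA i) (act B u)
  obtain ⟨j, b, hb, he'⟩ := exists_act_eq (hB l) u
  have h := le_mul_apply A B i l j
  rw [ha, hb, ← WithBot.coe_add] at h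
  have hne : mul A B i j ≠ ⊥ := by
    intro h0
    simp [h0] at h
  obtain ⟨w, hw⟩ := WithBot.ne_bot_iff_exists.1 hne
  rw [← hw, WithBot.coe_le_coe] at h
  exact ⟨j, w, hw.symm, le_antisymm (by linarith) (le i j w hw.symm)⟩

theorem mul_row {A B : Mat k} (hA : ∀ i, ∃ j, A i j ≠ ⊥) (hB : ∀ i, ∃ j, B i j ≠ ⊥) (i : Fin k) :
    ∃ j, mul A B i j ≠ ⊥ := by
  obtain ⟨l, hl⟩ := hA i
  obtain ⟨j, hj⟩ := hB l
  refine ⟨j, fun h => ?_⟩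
  have := le_mul_apply A B i l j
  rw [h, le_bot_iff, WithBot.add_eq_bot] at this
  tauto

theorem prod_row {U : ℕ → Mat k} (hU : ∀ n i, ∃ j, U n i j ≠ ⊥) (n : ℕ) (i : Fin k) :
    ∃ j, prod U n i j ≠ ⊥ := by
  induction n generalizing i with
  | zero => exact ⟨i, by simp [prod, one]⟩
  | succ n ih => exact mul_row (hU n) ih i

/-- Iterating the action maximizes over walks. -/
theorem iterate_act_isGreatest {A : Mat k} (hA : ∀ i, ∃ j, A i j ≠ ⊥) (u : Fin k → ℝ) (n : ℕ)
    (i : Fin k) : IsGreatest {y | ∃ j x, HasWalk A n x j i ∧ y = x + u j} ((act A)^[n] u i) := by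
  induction n generalizing i with
  | zero =>
    refine ⟨⟨i, 0, .refl A i, by simp⟩, ?_⟩
    rintro y ⟨j, x, ⟨rfl, rfl⟩, rfl⟩
    simp
  | succ n ih =>
    rw [Function.iterate_succ_apply']
    constructor
    · obtain ⟨l, w, hw, he⟩ := exists_act_eq (hA i) ((act A)^[n] u)
      obtain ⟨j, x, hx, he'⟩ := (ih l).1
      exact ⟨j, x + w, hx.snoc hw, by rw [he, he']; ring⟩
    · rintro y ⟨j, x, ⟨l, z, w, hz, hw, rfl⟩, rfl⟩
      linarith [le_act hw ((act A)^[n] u), (ih l).2 ⟨j, z, hz, rfl⟩]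

/-! ### Matrices with nonpositive entries -/

theorem HasWalk.nonpos {B : Mat k} (hB : ∀ i j, B i j ≤ 0) {n : ℕ} {x : ℝ} {i j : Fin k}
    (h : HasWalk B n x i j) : x ≤ 0 := by
  induction n generalizing x j with
  | zero => exact h.1.le
  | succ n ih =>
    obtain ⟨l, y, w, hy, hw, rfl⟩ := h
    have : (w : WithBot ℝ) ≤ (0 : ℝ) := hw ▸ hB j l
    linarith [ih hy, WithBot.coe_le_coe.1 this]

/-- There are finitely many negative entries, hence a least loss δ, and a walk of nonzero weight
uses at least one of them. -/
theorem exists_gap {B : Mat k} (hB : ∀ i j, B i j ≤ 0) :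
    ∃ δ > 0, ∀ n x i j, HasWalk B n x i j → x = 0 ∨ x ≤ -δ := by
  have ev : ∀ᶠ δ : ℝ in 𝓝[>] 0, ∀ i j, (B i j).unbotD 0 < 0 → (B i j).unbotD 0 ≤ -δ := by
    rw [eventually_all]; intro i
    rw [eventually_all]; intro j
    by_cases h : (B i j).unbotD 0 < 0
    · filter_upwards [Ioc_mem_nhdsGT (neg_pos.2 h)] with δ hδ _
      linarith [hδ.2]
    · exact Eventually.of_forall fun δ h' => absurd h' h
  obtain ⟨δ, hδ, hpos⟩ := (ev.and self_mem_nhdsWithin).exists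
  refine ⟨δ, hpos, fun n => ?_⟩
  induction n with
  | zero => exact fun x i j h => .inl h.1
  | succ n ih =>
    rintro x i j ⟨l, y, w, hy, hw, rfl⟩
    have hw0 : (w : WithBot ℝ) ≤ (0 : ℝ) := hw ▸ hB j l
    rw [WithBot.coe_le_coe] at hw0
    have h1 := hδ j l
    rw [hw, WithBot.unbotD_coe] at h1
    rcases hw0.lt_or_eq with h2 | rfl
    · exact .inr (by linarith [h1 h2, hy.nonpos hB])
    · simpa using ih y i l hy

/-- A long walk meets the set `G` of nodes, which contains all nodes of circuits of weight zero,
or it is very light. -/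
theorem HasWalk.meets_or_le {B : Mat k} (hB : ∀ i j, B i j ≤ 0) {G : Fin k → Prop}
    (hG : ∀ s n, 0 < n → HasWalk B n 0 s s → G s) {δ : ℝ}
    (hδ : ∀ n x i j, HasWalk B n x i j → x = 0 ∨ x ≤ -δ) (R : ℕ) {m : ℕ} {x : ℝ} {i j : Fin k}
    (h : HasWalk B (m + k * R) x i j) :
    (∃ s n₁ n₂ x₁ x₂, G s ∧ HasWalk B n₁ x₁ i s ∧ HasWalk B n₂ x₂ s j ∧ x = x₁ + x₂) ∨
      x ≤ -(R * δ) := by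
  induction R generalizing x j with
  | zero => exact .inr (by simpa using h.nonpos hB)
  | succ R ih =>
    -- The last `k` arcs contain a circuit: either it has weight zero and its base lies in `G`, or
    -- it costs another δ.
    rw [Nat.mul_succ, ← add_assoc] at h
    obtain ⟨l, y, z, hy, hz, rfl⟩ := h.split
    rcases ih hy with ⟨s, n₁, n₂, x₁, x₂, hs, h1, h2, rfl⟩ | hle
    · exact .inl ⟨s, n₁, _, x₁, _, hs, h1, h2.trans hz, by ring⟩
    · obtain ⟨s, n₁, n₂, n₃, x₁, x₂, x₃, h1, h2, h3, hpos, -, rfl⟩ := hz.exists_circuit le_rfl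
      rcases hδ _ _ _ _ h2 with rfl | hlt
      · exact .inl ⟨s, _, _, _, _, hG s n₂ hpos h2, hy.trans h1, h3, by ring⟩
      · right
        push_cast
        linarith [h1.nonpos hB, h3.nonpos hB]

/-- A matrix with nonpositive entries whose zero arcs form, up to transient parts, a single
aperiodic class ultimately maps every vector to a constant vector. -/
theorem exists_iterate_act_const {B : Mat k} (hrow : ∀ i, ∃ j, B i j ≠ ⊥) (hB : ∀ i j, B i j ≤ 0)
    {c : Fin k} {n₀ : ℕ} (hcc : ∀ n ≥ n₀, HasWalk B n 0 c c) (hto : ∀ i, ∃ n, HasWalk B n 0 c i)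
    (hfrom : ∀ s n, 0 < n → HasWalk B n 0 s s → ∃ m, HasWalk B m 0 s c)
    (hirr : ∀ j, ∃ n x, HasWalk B n x j c) :
    ∃ p, ∀ (u : Fin k → ℝ) i j, (act B)^[p] u i = (act B)^[p] u j := by
  choose b lb hb hbmax using fun j => exists_max_walk (fun n x i h => h.nonpos hB) (hirr j)
  choose lc hlc using hto
  obtain ⟨δ, hδ, hgap⟩ := exists_gap hB
  -- With `R` blocks of `k` arcs, a walk missing the critical nodes is already no heavier than the
  -- best walk to `c`.
  obtain ⟨R, hR⟩ : ∃ R : ℕ, ∀ j, -(R * δ) ≤ b j := by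
    have : ∀ᶠ R : ℕ in atTop, ∀ j, -(R * δ) ≤ b j := by
      rw [eventually_all]; intro j
      filter_upwards [eventually_ge_atTop ⌈-b j / δ⌉₊] with R hR
      have := Nat.ceil_le.1 hR
      rw [div_le_iff₀ hδ] at this
      linarith
    exact this.exists
  have hp : ∀ i j, n₀ + lb j + lc i ≤ n₀ + ∑ j, lb j + ∑ i, lc i := fun i j => by
    have h1 := Finset.single_le_sum (f := lb) (fun _ _ => Nat.zero_le _) (Finset.mem_univ j)
    have h2 := Finset.single_le_sum (f := lc) (fun _ _ => Nat.zero_le _) (Finset.mem_univ i)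
    omega
  set q := n₀ + ∑ j, lb j + ∑ i, lc i
  refine ⟨q + k * R, fun u => ?_⟩
  have upper : ∀ i j x, HasWalk B (q + k * R) x j i → x ≤ b j := by
    intro i j x hx
    rcases hx.meets_or_le hB hfrom hgap R with ⟨s, n₁, n₂, x₁, x₂, ⟨m, hm⟩, h1, h2, rfl⟩ | hle
    · linarith [hbmax j _ _ (h1.trans hm), h2.nonpos hB]
    · exact hle.trans (hR j)
  -- Best walk from `j` to `c`, then a zero loop at `c` absorbing the remaining length, then a zero
  -- walk to `i`. The choice of `q` keeps the loop length at least `n₀`.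
  have lower : ∀ i j, HasWalk B (q + k * R) (b j) j i := by
    intro i j
    have h := ((hb j).trans (hcc (q + k * R - lb j - lc i) (by have := hp i j; omega))).trans
      (hlc i)
    rw [add_zero, add_zero] at h
    convert h using 1
    have := hp i j
    omega
  have le : ∀ i j, (act B)^[q + k * R] u i ≤ (act B)^[q + k * R] u j := by
    intro i j
    obtain ⟨l, x, hx, he⟩ := (iterate_act_isGreatest hrow u (q + k * R) i).1
    have := (iterate_act_isGreatest hrow u (q + k * R) j).2 ⟨l, b l, lower j l, rfl⟩
    linarith [upper i l x hx]
  exact fun i j => le_antisymm (le i j) (le j i)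

/-! ### Diagonal scaling -/

/-- The matrix with entries `C i j + a j - a i - μ`. -/
noncomputable def scale (C : Mat k) (a : Fin k → ℝ) (μ : ℝ) : Mat k :=
  fun i j => C i j + ((a j - a i - μ : ℝ) : WithBot ℝ)

theorem scale_ne_bot {C : Mat k} {a : Fin k → ℝ} {μ : ℝ} {i j : Fin k} :
    scale C a μ i j ≠ ⊥ ↔ C i j ≠ ⊥ := by
  simp [scale, WithBot.add_eq_bot]

theorem scale_of_eq {C : Mat k} {i j : Fin k} {w : ℝ} (h : C i j = (w : WithBot ℝ))
    (a : Fin k → ℝ) (μ : ℝ) : scale C a μ i j = ((w + (a j - a i - μ) : ℝ) : WithBot ℝ) := by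
  rw [scale, h, WithBot.coe_add]

/-- The potential differences telescope, so only the endpoints and the length matter; a circuit of
length `n` just loses `n * μ`. -/
theorem HasWalk.scale {C : Mat k} {n : ℕ} {x : ℝ} {i j : Fin k} (h : HasWalk C n x i j)
    (a : Fin k → ℝ) (μ : ℝ) : HasWalk (scale C a μ) n (x + a i - a j - n * μ) i j := by
  induction n generalizing x j with
  | zero => obtain ⟨rfl, rfl⟩ := h; exact ⟨by simp, rfl⟩
  | succ n ih =>
    obtain ⟨l, y, w, hy, hw, rfl⟩ := h
    refine ⟨l, _, _, ih hy, scale_of_eq hw a μ, ?_⟩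
    push_cast
    ring

theorem HasWalk.of_scale {C : Mat k} {n : ℕ} {x : ℝ} {i j : Fin k} {a : Fin k → ℝ} {μ : ℝ}
    (h : HasWalk (MaxPlus.scale C a μ) n x i j) : HasWalk C n (x - a i + a j + n * μ) i j := by
  induction n generalizing x j with
  | zero => obtain ⟨rfl, rfl⟩ := h; exact ⟨by simp, rfl⟩
  | succ n ih =>
    obtain ⟨l, y, w, hy, hw, rfl⟩ := h
    have hne : C j l ≠ ⊥ := scale_ne_bot.1 (by rw [hw]; exact WithBot.coe_ne_bot)
    obtain ⟨v, hv⟩ := WithBot.ne_bot_iff_exists.1 hne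
    refine ⟨l, _, v, ih hy, hv.symm, ?_⟩
    rw [scale_of_eq hv.symm, WithBot.coe_inj] at hw
    rw [← hw]
    push_cast
    ring

theorem act_scale {C : Mat k} (hC : ∀ i, ∃ j, C i j ≠ ⊥) (a : Fin k → ℝ) (μ : ℝ) (u : Fin k → ℝ)
    (i : Fin k) : act (scale C a μ) u i = act C (fun j => u j + a j) i - a i - μ := by
  obtain ⟨j, w, hw, he⟩ := exists_act_eq (hC i) fun j => u j + a j
  refine act_eq_of ⟨j, _, scale_of_eq hw a μ, by rw [he]; ring⟩ fun l v hv => ?_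
  have hne : C i l ≠ ⊥ := scale_ne_bot.1 (by rw [hv]; exact WithBot.coe_ne_bot)
  obtain ⟨z, hz⟩ := WithBot.ne_bot_iff_exists.1 hne
  rw [scale_of_eq hz.symm, WithBot.coe_inj] at hv
  have := le_act hz.symm fun j => u j + a j
  rw [← hv]
  linarith

theorem iterate_act_scale {C : Mat k} (hC : ∀ i, ∃ j, C i j ≠ ⊥) (a : Fin k → ℝ) (μ : ℝ)
    (u : Fin k → ℝ) (n : ℕ) (i : Fin k) :
    (act (scale C a μ))^[n] u i = (act C)^[n] (fun j => u j + a j) i - a i - n * μ := by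
  induction n generalizing i with
  | zero => simp
  | succ n ih =>
    rw [Function.iterate_succ_apply', Function.iterate_succ_apply', act_scale hC,
      act_const_add hC (a := -(n * μ)) (v := (act C)^[n] fun j => u j + a j)
        (fun j => by rw [ih]; ring)]
    push_cast
    ring

end MaxPlus

namespace MaxPlus

variable {k : ℕ}

/-! ### Critical circuits -/

theorem HasWalk.exists_isCircuit {C : Mat k} {n : ℕ} {x : ℝ} {s : Fin k} (h : HasWalk C n x s s)
    (hn : 0 < n) : ∃ t, IsCircuit C n t ∧ t 0 = s ∧ avgWeight C n t = x / n := by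
  obtain ⟨t, h0, hn', ht, rfl⟩ := h.exists_fun
  exact ⟨t, ⟨hn, hn'.trans h0.symm, ht⟩, h0, rfl⟩

theorem IsCriticalCircuit.avgWeight_eq {C : Mat k} {n n' : ℕ} {t t' : ℕ → Fin k}
    (h : IsCriticalCircuit C n t) (h' : IsCriticalCircuit C n' t') :
    avgWeight C n t = avgWeight C n' t' :=
  le_antisymm (h'.2 _ _ h.1) (h.2 _ _ h'.1)

/-- If scaling makes all entries nonpositive, with `μ` the maximal average weight of circuits, then
it makes the entries of critical arcs vanish. -/
theorem IsCriticalCircuit.scale_eq_zero {C : Mat k} {n : ℕ} {t : ℕ → Fin k}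
    (h : IsCriticalCircuit C n t) {a : Fin k → ℝ}
    (hle : ∀ i j, scale C a (avgWeight C n t) i j ≤ 0) {m : ℕ} (hm : m < n) :
    scale C a (avgWeight C n t) (t (m + 1)) (t m) = 0 := by
  set μ := avgWeight C n t with hμ
  have hn : (n : ℝ) ≠ 0 := Nat.cast_ne_zero.2 h.1.1.ne'
  have arc : ∀ m < n, scale C a μ (t (m + 1)) (t m) =
      (((C (t (m + 1)) (t m)).unbotD 0 + (a (t m) - a (t (m + 1)) - μ) : ℝ) : WithBot ℝ) := by
    intro m hm
    obtain ⟨w, hw⟩ := WithBot.ne_bot_iff_exists.1 (h.1.2.2 m hm)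
    rw [← hw, WithBot.unbotD_coe]
    exact scale_of_eq hw.symm a μ
  -- Around the circuit the potentials cancel and the weights add up to `n * μ`. Nonpositive terms
  -- with sum zero all vanish.
  have sum : ∑ m ∈ Finset.range n,
      ((C (t (m + 1)) (t m)).unbotD 0 + (a (t m) - a (t (m + 1)) - μ)) = 0 := by
    have h1 : ∑ m ∈ Finset.range n, (C (t (m + 1)) (t m)).unbotD 0 = n * μ := by
      rw [hμ, avgWeight, mul_div_cancel₀ _ hn]
    rw [Finset.sum_add_distrib, Finset.sum_sub_distrib, Finset.sum_range_sub' (fun m => a (t m)),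
      h1, h.1.2.1]
    simp
  have nonpos : ∀ m ∈ Finset.range n,
      (C (t (m + 1)) (t m)).unbotD 0 + (a (t m) - a (t (m + 1)) - μ) ≤ 0 := by
    intro m hm
    have := hle (t (m + 1)) (t m)
    rw [arc m (Finset.mem_range.1 hm)] at this
    exact_mod_cast this
  rw [arc m hm, (Finset.sum_eq_zero_iff_of_nonpos nonpos).1 sum m (Finset.mem_range.2 hm)]
  rfl

/-! ### Strongly connected graphs of cyclicity one -/

/-- Since `sInf ∅ = 0`, the value 1 shows that common multiples exist, so the infimum is attained.
-/
theorem scsCyclicity_dvd_one {V : Type*} {G : Digraph V} (h : graphCyclicity G = 1) {S : Set V}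
    (hS : IsScs G S) : scsCyclicity G S ∣ 1 := by
  have hmem := Nat.sInf_mem (Nat.nonempty_of_pos_sInf (s := {m | 0 < m ∧ ∀ S, IsScs G S →
    scsCyclicity G S ∣ m}) (by rw [graphCyclicity] at h; omega))
  rw [graphCyclicity] at h
  rw [h] at hmem
  exact hmem.2 S hS

/-- Without circuits every `d` would be a common divisor and the unbounded `sSup` would be 0. Hence
a circuit exists, and it bounds the set of divisors. -/
theorem eq_one_of_dvd_circuitLengths {V : Type*} {G : Digraph V} {S : Set V}
    (h : scsCyclicity G S = 1) {d : ℕ} (hd : ∀ n ∈ circuitLengths G S, d ∣ n) : d = 1 := by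
  have hne : (circuitLengths G S).Nonempty := by
    by_contra hc
    rw [Set.not_nonempty_iff_eq_empty] at hc
    have : scsCyclicity G S = 0 := by
      rw [scsCyclicity]
      refine Nat.sSup_of_not_bddAbove ?_
      simp [hc]
    omega
  obtain ⟨n, hn⟩ := hne
  have hle : d ≤ 1 := h ▸ le_csSup (⟨n, fun e he => Nat.le_of_dvd hn.1 (he n hn)⟩ :
    BddAbove {d | ∀ n ∈ circuitLengths G S, d ∣ n}) hd
  have : d ≠ 0 := by
    rintro rfl
    exact hn.1.ne' (zero_dvd_iff.1 (hd n hn))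
  omega

theorem exists_forall_ge_mem_of_setGcd_eq_one (s : AddSubmonoid ℕ) (h : Nat.setGcd (s : Set ℕ) = 1) :
    ∃ n₀, ∀ n ≥ n₀, n ∈ s := by
  obtain ⟨n₀, hn₀⟩ := Nat.exists_mem_closure_of_ge (s : Set ℕ)
  refine ⟨n₀, fun n hn => ?_⟩
  simpa using hn₀ n hn (by simp [h])

/-- Some power of a scs1-cyc1 matrix maps all vectors to parallel vectors. -/
theorem IsScs1Cyc1.exists_iterate {C : Mat k} (h : IsScs1Cyc1 C) :
    ∃ p, ∀ u v, proj ((act C)^[p] u) = proj ((act C)^[p] v) := by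
  obtain ⟨hirr, ⟨S, ⟨c, hS⟩, huniq⟩, hcyc⟩ := h
  have hrow := hirr.exists_ne_bot
  obtain ⟨n₀, t₀, hcrit, -⟩ := c.2
  set μ := avgWeight C n₀ t₀ with hμ
  -- A circuit of positive normalized weight would have mean above μ.
  have closed : ∀ n x i, HasWalk (scale C 0 μ) n x i i → x ≤ 0 := by
    intro n x i hx
    rcases Nat.eq_zero_or_pos n with rfl | hn
    · exact hx.1.le
    · obtain ⟨t, ht, -, havg⟩ := hx.of_scale.exists_isCircuit hn
      have hle := hcrit.2 n t ht
      have hn' : (0 : ℝ) < n := Nat.cast_pos.2 hn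
      rw [havg, div_le_iff₀ hn', ← hμ] at hle
      simp only [Pi.zero_apply] at hle
      linarith
  choose a la ha hamax using fun i => exists_max_walk closed (i := c.1) (j := i) (by
    obtain ⟨n, x, hx⟩ := hirr.exists_hasWalk c.1 i
    exact ⟨n, _, hx.scale 0 μ⟩)
  have hac : a c.1 = 0 := le_antisymm (closed _ _ _ (ha c.1)) (hamax c.1 0 0 (.refl _ _))
  set B := scale C a μ with hBdef
  -- A heaviest walk from `c` to `j` followed by the arc to `i` competes in the maximum `a i`.
  have hB : ∀ i j, B i j ≤ 0 := by
    intro i j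
    by_cases hij : C i j = ⊥
    · simp [hBdef, scale, hij]
    · obtain ⟨w, hw⟩ := WithBot.ne_bot_iff_exists.1 hij
      have := hamax i _ _ ((ha j).snoc (scale_of_eq hw.symm 0 μ))
      simp only [Pi.zero_apply] at this
      rw [hBdef, scale_of_eq hw.symm, ← WithBot.coe_zero, WithBot.coe_le_coe]
      linarith
  -- The walk realizing `a i` has weight `a i + a c - a i = 0` after scaling by the potential.
  have hto : ∀ i, ∃ n, HasWalk B n 0 c.1 i := by
    intro i
    refine ⟨la i, ?_⟩
    have := (ha i).of_scale.scale a μ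
    simp only [Pi.zero_apply, hac] at this
    convert this using 1
    ring
  have adj : ∀ i j, (criticalGraph C).Adj i j → B j.1 i.1 = ((0 : ℝ) : WithBot ℝ) := by
    rintro i j ⟨n, t, ht, m, hm, hi, hj⟩
    have he : avgWeight C n t = μ := ht.avgWeight_eq hcrit
    have := ht.scale_eq_zero (a := a) (by rw [he]; exact hB) hm
    rw [he, hi, hj] at this
    exact this
  have reach : ∀ i j, Relation.ReflTransGen (criticalGraph C).Adj i j →
      ∃ n, HasWalk B n 0 i.1 j.1 := by
    intro i j hij
    induction hij with
    | refl => exact ⟨0, .refl _ _⟩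
    | tail _ hadj ih =>
      obtain ⟨n, hn⟩ := ih
      exact ⟨n + 1, by simpa using hn.snoc (adj _ _ hadj)⟩
  have hscs : IsScs (criticalGraph C) S := ⟨c, hS⟩
  have hfrom : ∀ s n, 0 < n → HasWalk B n 0 s s → ∃ m, HasWalk B m 0 s c.1 := by
    intro s n hn hs
    obtain ⟨t, ht, h0, havg⟩ := hs.of_scale.exists_isCircuit hn
    have hn' : (n : ℝ) ≠ 0 := Nat.cast_ne_zero.2 hn.ne'
    have havg' : avgWeight C n t = μ := by
      rw [havg]
      field_simp
      ring
    have hs' : IsCriticalNode C s :=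
      ⟨n, t, ⟨ht, fun n' t' h' => havg' ▸ hcrit.2 n' t' h'⟩, 0, hn, h0⟩
    -- The class of `s` in the critical graph is an s.c.s., hence it is `S`, which contains `c`.
    have hmem : c ∈ {w | Relation.ReflTransGen (criticalGraph C).Adj ⟨s, hs'⟩ w ∧
        Relation.ReflTransGen (criticalGraph C).Adj w ⟨s, hs'⟩} := by
      rw [huniq _ ⟨⟨s, hs'⟩, rfl⟩, hS]
      exact ⟨.refl, .refl⟩
    exact reach _ _ hmem.1
  let T : AddSubmonoid ℕ :=
    { carrier := {n | HasWalk B n 0 c.1 c.1}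
      zero_mem' := HasWalk.refl B c.1
      add_mem' := fun {m n} (hm : HasWalk B m 0 _ _) (hn : HasWalk B n 0 _ _) => by
        simpa using hm.trans hn }
  -- A circuit of length `n` in `S` may avoid `c`. Joining it to `c` by zero walks gives loops of
  -- lengths `p + q` and `p + n + q`, so the gcd of `T` divides `n`.
  have hgcd : Nat.setGcd (T : Set ℕ) = 1 := by
    refine eq_one_of_dvd_circuitLengths (Nat.dvd_one.1 (scsCyclicity_dvd_one hcyc hscs)) ?_
    rintro n ⟨-, t, htn, ht, htS⟩
    have walk : ∀ m ≤ n, HasWalk B m 0 (t 0).1 (t m).1 := by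
      intro m hm
      induction m with
      | zero => exact .refl _ _
      | succ m ih => simpa using (ih (by omega)).snoc (adj _ _ (ht m (by omega)))
    have h0 := htS 0 (Nat.zero_le _)
    rw [hS] at h0
    obtain ⟨p, hp⟩ := reach _ _ h0.1
    obtain ⟨q, hq⟩ := reach _ _ h0.2
    have hn := walk n le_rfl
    rw [htn] at hn
    have h1 : p + q ∈ (T : Set ℕ) := by
      change HasWalk B _ 0 _ _
      simpa using hp.trans hq
    have h2 : p + n + q ∈ (T : Set ℕ) := by
      change HasWalk B _ 0 _ _
      simpa using (hp.trans hn).trans hq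
    have h3 := Nat.setGcd_dvd_of_mem h2
    rw [show p + n + q = n + (p + q) by ring] at h3
    exact (Nat.dvd_add_left (Nat.setGcd_dvd_of_mem h1)).1 h3
  obtain ⟨n₁, hn₁⟩ := exists_forall_ge_mem_of_setGcd_eq_one T hgcd
  obtain ⟨p, hp⟩ := exists_iterate_act_const (B := B)
    (fun i => (hrow i).imp fun j hj => scale_ne_bot.2 hj) hB hn₁ hto hfrom (fun j => by
      obtain ⟨n, x, hx⟩ := hirr.exists_hasWalk j c.1
      exact ⟨n, _, hx.scale a μ⟩)
  have key : ∀ u i, (act C)^[p] u i = (act B)^[p] (fun j => u j - a j) c.1 + a i + p * μ := by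
    intro u i
    rw [← hp _ i c.1, hBdef, iterate_act_scale hrow]
    simp only [sub_add_cancel]
    ring
  refine ⟨p, fun u v => proj_eq_iff.2
    ⟨(act B)^[p] (fun j => u j - a j) c.1 - (act B)^[p] (fun j => v j - a j) c.1, fun i => ?_⟩⟩
  rw [key u, key v]
  ring

end MaxPlus

namespace MaxPlus

/-! ### Measurability -/

theorem measurable_coe_rmax : Measurable fun r : ℝ => (r : WithBot ℝ) := fun _ hs => hs

theorem measurable_unbotD_rmax : Measurable fun a : WithBot ℝ => a.unbotD 0 := fun _ hs => hs

instance instMeasurableSingletonClassRmax : MeasurableSingletonClass (WithBot ℝ) where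
  measurableSet_singleton a := by
    change MeasurableSet ((fun r : ℝ => (r : WithBot ℝ)) ⁻¹' {a})
    exact (Set.subsingleton_singleton.preimage WithBot.coe_injective).measurableSet

section

variable {α : Type*} [MeasurableSpace α]

theorem measurable_rmax_of {f : α → WithBot ℝ} (h : MeasurableSet {x | f x = ⊥}) {g : α → ℝ}
    (hg : Measurable g) (hfg : ∀ x, f x ≠ ⊥ → f x = g x) : Measurable f := by
  classical
  have : f = fun x => if f x = ⊥ then ⊥ else (g x : WithBot ℝ) := by
    funext x
    split_ifs with hx
    · exact hx
    · exact hfg x hx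
  rw [this]
  exact Measurable.ite h measurable_const (measurable_coe_rmax.comp hg)

theorem measurable_rmax_add {f g : α → WithBot ℝ} (hf : Measurable f) (hg : Measurable g) :
    Measurable fun x => f x + g x := by
  refine measurable_rmax_of (g := fun x => (f x).unbotD 0 + (g x).unbotD 0) ?_
    ((measurable_unbotD_rmax.comp hf).add (measurable_unbotD_rmax.comp hg)) fun x hx => ?_
  · simp only [WithBot.add_eq_bot]
    exact (hf (measurableSet_singleton ⊥)).union (hg (measurableSet_singleton ⊥))
  · rw [Ne, WithBot.add_eq_bot, not_or] at hx
    obtain ⟨a, ha⟩ := WithBot.ne_bot_iff_exists.1 hx.1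
    obtain ⟨b, hb⟩ := WithBot.ne_bot_iff_exists.1 hx.2
    simp [← ha, ← hb]

theorem measurable_rmax_sup {f g : α → WithBot ℝ} (hf : Measurable f) (hg : Measurable g) :
    Measurable fun x => f x ⊔ g x := by
  classical
  have hf' := hf (measurableSet_singleton ⊥)
  have hg' := hg (measurableSet_singleton ⊥)
  have h1 := measurable_unbotD_rmax.comp hf
  have h2 := measurable_unbotD_rmax.comp hg
  refine measurable_rmax_of (g := fun x => if f x = ⊥ then (g x).unbotD 0 else
    if g x = ⊥ then (f x).unbotD 0 else (f x).unbotD 0 ⊔ (g x).unbotD 0) ?_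
    (Measurable.ite hf' h2 (Measurable.ite hg' h1 (h1.sup h2))) fun x hx => ?_
  · simp only [sup_eq_bot_iff]
    exact hf'.inter hg'
  · rw [Ne, sup_eq_bot_iff] at hx
    cases hfx : f x <;> cases hgx : g x <;> simp_all

theorem measurable_rmax_finset_sup {ι : Type*} (s : Finset ι) {f : ι → α → WithBot ℝ}
    (hf : ∀ i, Measurable (f i)) : Measurable fun x => s.sup fun i => f i x := by
  classical
  induction s using Finset.induction_on with
  | empty => simp
  | insert i s _ ih => simpa using measurable_rmax_sup (hf i) ih

theorem measurable_act {k : ℕ} {A : α → Mat k} {u : α → Fin k → ℝ} (hA : Measurable A)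
    (hu : Measurable u) : Measurable fun x => act (A x) (u x) := by
  refine measurable_pi_iff.2 fun i => measurable_unbotD_rmax.comp <|
    measurable_rmax_finset_sup _ fun j => measurable_rmax_add ?_ ?_
  · exact (measurable_pi_apply j).comp ((measurable_pi_apply i).comp hA)
  · exact measurable_coe_rmax.comp ((measurable_pi_apply j).comp hu)

end

theorem measurable_proj {k : ℕ} : Measurable (proj : (Fin k → ℝ) → Proj k) :=
  measurable_quotient_mk''

section Stochastic

variable {Ω : Type*} [MeasurableSpace Ω] {k : ℕ} {θ : Ω ≃ᵐ Ω} {A : Ω → Mat k}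

theorem measurable_state (hA : Measurable A) {x₀ : Ω → Fin k → ℝ} (hx : Measurable x₀) (n : ℕ) :
    Measurable (state θ A x₀ n) := by
  induction n with
  | zero => exact hx
  | succ n ih => exact measurable_act (hA.comp (θ.measurable.iterate n)) ih

/-! ### Composition of the dynamics -/

theorem state_congr {x₀ x₁ : Ω → Fin k → ℝ} {ω : Ω} (h : x₀ ω = x₁ ω) (n : ℕ) :
    state θ A x₀ n ω = state θ A x₁ n ω := by
  induction n with
  | zero => exact h
  | succ n ih => simp only [state, ih]

/-- Cocycle property over θ: restart at time `n` from the current state, frozen as a constant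
initial condition. -/
theorem state_add (x₀ : Ω → Fin k → ℝ) (m n : ℕ) (ω : Ω) :
    state θ A x₀ (n + m) ω = state θ A (fun _ => state θ A x₀ n ω) m (θ^[n] ω) := by
  induction m with
  | zero => rfl
  | succ m ih =>
    rw [← add_assoc]
    simp only [state, ih, matSeq]
    rw [← Function.iterate_add_apply, add_comm m n]

theorem state_eq_act_prod {U : ℕ → Mat k} (hU : ∀ n i, ∃ j, U n i j ≠ ⊥) {n : ℕ} {ω : Ω}
    (h : ∀ i < n, A (θ^[i] ω) = U i) (u : Fin k → ℝ) :
    state θ A (fun _ => u) n ω = act (prod U n) u := by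
  induction n with
  | zero => exact (act_one u).symm
  | succ n ih =>
    rw [prod, act_mul (hU n) (prod_row hU n), ← ih fun i hi => h i (by omega)]
    simp only [state, matSeq, h n (by omega)]

theorem state_eq_iterate_act_prod {U : ℕ → Mat k} (hU : ∀ n i, ∃ j, U n i j ≠ ⊥) {N p : ℕ} {ω : Ω}
    (h : ∀ i < N * p, A (θ^[i] ω) = U (i % N)) (u : Fin k → ℝ) :
    state θ A (fun _ => u) (N * p) ω = (act (prod U N))^[p] u := by
  induction p with
  | zero => rfl
  | succ p ih =>
    rw [Nat.mul_succ, state_add, Function.iterate_succ_apply',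
      ih fun i hi => h i (by rw [Nat.mul_succ]; omega)]
    refine state_eq_act_prod hU (fun i hi => ?_) _
    rw [← Function.iterate_add_apply, h _ (by rw [Nat.mul_succ]; omega), Nat.add_mul_mod_self_left,
      Nat.mod_eq_of_lt hi]

theorem iterate_symm_iterate (θ : Ω ≃ᵐ Ω) (n : ℕ) (ω : Ω) : θ^[n] (θ.symm^[n] ω) = ω :=
  Function.LeftInverse.iterate (f := θ.symm) (g := θ) θ.apply_symm_apply n ω

theorem iterate_iterate_symm_add (θ : Ω ≃ᵐ Ω) (m n : ℕ) (ω : Ω) :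
    θ^[m] (θ.symm^[m + n] ω) = θ.symm^[n] ω := by
  rw [Function.iterate_add_apply, iterate_symm_iterate]

/-- After `m` steps from the past, the direction of the state has forgotten the initial condition,
and remembers it no more when started from a more remote past. -/
theorem proj_state_eq_of_coupled {ω : Ω} (hω : ∀ n i, ∃ j, A (θ.symm^[n] ω) i j ≠ ⊥) {m q r : ℕ}
    (hc : ∀ u v, proj (state θ A (fun _ => u) m (θ.symm^[m + q] ω)) =
      proj (state θ A (fun _ => v) m (θ.symm^[m + q] ω)))
    (x₀ x₁ : Ω → Fin k → ℝ) :
    proj (state θ A x₀ (r + (m + q)) (θ.symm^[r + (m + q)] ω)) =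
      proj (state θ A x₁ (m + q) (θ.symm^[m + q] ω)) := by
  have row : ∀ n < q, ∀ i, ∃ j, A (θ^[n] (θ.symm^[q] ω)) i j ≠ ⊥ := by
    intro n hn
    obtain ⟨d, rfl⟩ := Nat.exists_eq_add_of_le hn.le
    rw [iterate_iterate_symm_add]
    exact hω d
  have cong : ∀ u v : Fin k → ℝ, proj u = proj v → ∀ n ≤ q,
      proj (state θ A (fun _ => u) n (θ.symm^[q] ω)) =
        proj (state θ A (fun _ => v) n (θ.symm^[q] ω)) := by
    intro u v huv n hn
    induction n with
    | zero => exact huv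
    | succ n ih => exact proj_act_congr (row n (by omega)) (ih (by omega))
  -- At time `-q` both trajectories leave the same coupling window, hence are parallel; the last `q`
  -- steps preserve this.
  rw [state_add, iterate_iterate_symm_add, state_add, iterate_iterate_symm_add,
    state_add (θ := θ) (A := A) x₁, iterate_iterate_symm_add]
  refine cong _ _ ?_ q le_rfl
  rw [state_congr (x₀ := x₁) (x₁ := fun _ => x₁ (θ.symm^[m + q] ω)) rfl]
  exact hc _ _

/-! ### Recurrence of the pattern -/

variable {P : Measure Ω}

theorem measure_iterate_symm (hθ : MeasurePreserving θ P P) (s : Set Ω) (n : ℕ) :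
    P (θ.symm^[n] ⁻¹' s) = P s := by
  induction n generalizing s with
  | zero => rfl
  | succ n ih =>
    rw [Function.iterate_succ, Set.preimage_comp, (hθ.symm θ).measure_preimage_equiv, ih]

/-- The set of points that visit `E` in the past is contained in its preimage under θ, so it is null
or conull by ergodicity; it contains `E`. -/
theorem ae_exists_iterate_symm_mem [IsFiniteMeasure P] (hθ : Ergodic θ P) {E : Set Ω} (hE : MeasurableSet E)
    (hpos : 0 < P E) : ∀ᵐ ω ∂P, ∃ n, θ.symm^[n] ω ∈ E := by
  set U := {ω | ∃ n, θ.symm^[n] ω ∈ E} with hU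
  have hUm : MeasurableSet U := by
    rw [hU, Set.ofPred_exists]
    exact MeasurableSet.iUnion fun n => θ.symm.measurable.iterate n hE
  have hsub : U ⊆ θ ⁻¹' U := by
    rintro ω ⟨n, hn⟩
    exact ⟨n + 1, by simpa [Function.iterate_succ_apply] using hn⟩
  rcases hθ.ae_empty_or_univ_of_ae_le_preimage hUm.nullMeasurableSet
    (LE.le.eventuallyLE hsub) with h | h
  · have hE0 : P E ≤ P U := measure_mono fun ω hω => ⟨0, hω⟩
    rw [measure_congr h, measure_empty] at hE0
    exact absurd hE0 (not_le.2 hpos)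
  · exact eventuallyEq_univ.1 h

/-- Independence factors the probability, and invariance makes each factor positive. -/
theorem measure_pattern_pos {M : ℕ → Mat k} (hθ : MeasurePreserving θ P P) (hA : Measurable A)
    (hindep : iIndepFun (fun n => matSeq θ A n) P) (hpos : ∀ i, 0 < P {ω | A ω = M i}) (n : ℕ) :
    0 < P {ω | ∀ i < n, A (θ^[i] ω) = M i} := by
  have heq : {ω | ∀ i < n, A (θ^[i] ω) = M i} =
      ⋂ i ∈ Finset.range n, matSeq θ A i ⁻¹' {M i} := by
    ext ω
    simp [matSeq]
  rw [heq, hindep.measure_inter_preimage_eq_mul (Finset.range n)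
    (fun i _ => measurableSet_singleton (M i))]
  refine CanonicallyOrderedAdd.prod_pos.2 fun i _ => ?_
  have := (hθ.iterate i).measure_preimage (hA (measurableSet_singleton (M i))).nullMeasurableSet
  change 0 < P (θ^[i] ⁻¹' (A ⁻¹' {M i}))
  rw [this]
  exact hpos i

theorem measurableSet_pattern (hA : Measurable A) (M : ℕ → Mat k) (n : ℕ) :
    MeasurableSet {ω | ∀ i < n, A (θ^[i] ω) = M i} := by
  simp only [Set.ofPred_forall]
  exact MeasurableSet.iInter fun i => MeasurableSet.iInter fun _ =>
    (hA.comp (θ.measurable.iterate i)) (measurableSet_singleton (M i))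

end Stochastic

end MaxPlus

namespace MaxPlus

-- Coupling from the past and its consequences

section Stochastic

variable {Ω : Type*} [MeasurableSpace Ω] {k : ℕ} {θ : Ω ≃ᵐ Ω} {A : Ω → Mat k}
  {P : Measure Ω}

/-- The set on which the first `m` matrices map all vectors to parallel vectors. -/
def coupledSet (θ : Ω ≃ᵐ Ω) (A : Ω → Mat k) (m : ℕ) : Set Ω :=
  {ω | ∀ u v, proj (state θ A (fun _ => u) m ω) = proj (state θ A (fun _ => v) m ω)}

/-- The event is that the word of the pattern is read `p` times in a row, where the `p`-th power of
`C` has a single direction as image. Passing to this subset avoids proving `coupledSet` measurable.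
-/
theorem exists_coupled_event {L : Type*} {M : L → Mat k} (hθ : MeasurePreserving θ P P)
    (hM : ∀ l, Irreducible (M l)) (hA : Measurable A) (hpos : ∀ l, 0 < P {ω | A ω = M l})
    (hindep : iIndepFun (fun n => matSeq θ A n) P)
    (hpattern : ∃ C, IsPattern P θ M A C ∧ IsScs1Cyc1 C) :
    ∃ m, ∃ E ⊆ coupledSet θ A m, MeasurableSet E ∧ 0 < P E := by
  obtain ⟨C, ⟨N, -, ⟨u, rfl⟩, -⟩, hC⟩ := hpattern
  obtain ⟨p, hp⟩ := hC.exists_iterate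
  refine ⟨N * p, {ω | ∀ i < N * p, A (θ^[i] ω) = M (u (i % N))}, fun ω hω v w => ?_,
    measurableSet_pattern hA (fun i => M (u (i % N))) _,
    measure_pattern_pos (M := fun i => M (u (i % N))) hθ hA hindep (fun i => hpos _) _⟩
  have hrow : ∀ n i, ∃ j, M (u n) i j ≠ ⊥ := fun n => (hM (u n)).exists_ne_bot
  rw [state_eq_iterate_act_prod (U := fun n => M (u n)) hrow hω,
    state_eq_iterate_act_prod (U := fun n => M (u n)) hrow hω]
  exact hp v w

/-- If the dynamics couples with positive probability, the state started from the remote past does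
not depend on the initial condition, from some time on that is almost surely finite. -/
theorem exists_stationary_limit [IsFiniteMeasure P] (hθ : Ergodic θ P) (hA : Measurable A)
    (hrow : ∀ᵐ ω ∂P, ∀ i, ∃ j, A ω i j ≠ ⊥) {m : ℕ} {E : Set Ω} (hEsub : E ⊆ coupledSet θ A m)
    (hE : MeasurableSet E) (hpos : 0 < P E) :
    ∃ Z : Ω → Proj k, Measurable Z ∧ ∃ F : ℕ → Set Ω, Monotone F ∧ (∀ n, MeasurableSet (F n)) ∧
      (∀ᵐ ω ∂P, ∃ n, ω ∈ F n) ∧ ∀ᵐ ω ∂P, ∀ n, ω ∈ F n → ∀ x₀ : Ω → Fin k → ℝ,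
        proj (state θ A x₀ n (θ.symm^[n] ω)) = Z ω := by
  classical
  -- On `D n` the window of `m` steps ending at time `-n` is coupling.
  let D : ℕ → Set Ω := fun n => {ω | θ.symm^[m + n] ω ∈ E}
  have hD : ∀ n, MeasurableSet (D n) := fun n => θ.symm.measurable.iterate (m + n) hE
  let U : Set Ω := ⋃ n, D n
  have hU : MeasurableSet U := MeasurableSet.iUnion hD
  -- Adding the null set `Uᶜ` makes the first index exist everywhere, so `Z` is defined, measurably,
  -- on all of `Ω`.
  have hex : ∀ ω, ∃ n, ω ∈ D n ∪ Uᶜ := by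
    intro ω
    by_cases hω : ω ∈ U
    · obtain ⟨n, hn⟩ := Set.mem_iUnion.1 hω
      exact ⟨n, .inl hn⟩
    · exact ⟨0, .inr hω⟩
  let X : ℕ → Ω → Proj k := fun n ω => proj (state θ A (fun _ => 0) (m + n) (θ.symm^[m + n] ω))
  have hX : ∀ n, Measurable (X n) := fun n =>
    measurable_proj.comp ((measurable_state hA measurable_const _).comp
      (θ.symm.measurable.iterate _))
  have hUae : ∀ᵐ ω ∂P, ω ∈ U := by
    have h := ae_exists_iterate_symm_mem hθ hE hpos
    -- The visit to `E` must lie at least `m` steps back, so recurrence is applied to the point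
    -- shifted by `-m`.
    have hq := (((hθ.toMeasurePreserving.symm θ).iterate m).quasiMeasurePreserving).ae h
    filter_upwards [hq] with ω hω
    obtain ⟨n, hn⟩ := hω
    refine Set.mem_iUnion.2 ⟨n, ?_⟩
    change θ.symm^[m + n] ω ∈ E
    rwa [add_comm, Function.iterate_add_apply]
  have hrow' : ∀ᵐ ω ∂P, ∀ n i, ∃ j, A (θ.symm^[n] ω) i j ≠ ⊥ :=
    ae_all_iff.2 fun n =>
      (((hθ.toMeasurePreserving.symm θ).iterate n).quasiMeasurePreserving).ae hrow
  refine ⟨fun ω => X (Nat.find (hex ω)) ω,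
    Measurable.find (p := fun n ω => ω ∈ D n ∪ Uᶜ) hX (fun n => (hD n).union hU.compl) hex,
    fun n => {ω | ∃ q r, n = r + (m + q) ∧ ω ∈ D q}, ?_, ?_, ?_, ?_⟩
  · rintro n n' hn ω ⟨q, r, rfl, hq⟩
    obtain ⟨d, rfl⟩ := Nat.exists_eq_add_of_le hn
    exact ⟨q, d + r, by ring, hq⟩
  · intro n
    have : {ω | ∃ q r, n = r + (m + q) ∧ ω ∈ D q} =
        ⋃ q, ⋃ r, ⋃ (_ : n = r + (m + q)), D q := by
      ext ω
      simp
    simp only [this]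
    exact MeasurableSet.iUnion fun q => MeasurableSet.iUnion fun r =>
      MeasurableSet.iUnion fun _ => hD q
  · filter_upwards [hUae] with ω hω
    obtain ⟨q, hq⟩ := Set.mem_iUnion.1 hω
    exact ⟨m + q, q, 0, by simp, hq⟩
  · filter_upwards [hUae, hrow'] with ω hω hr n hn x₀
    obtain ⟨q, r, rfl, hq⟩ := hn
    rcases Nat.find_spec (hex ω) with hs | hs
    · -- both the pattern of `F` and the first pattern determine the state at a common later time
      set s := Nat.find (hex ω)
      have h1 : ∀ (x x' : Ω → Fin k → ℝ) (r : ℕ),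
          proj (state θ A x (r + (m + q)) (θ.symm^[r + (m + q)] ω)) =
            proj (state θ A x' (m + q) (θ.symm^[m + q] ω)) := fun x x' r =>
        proj_state_eq_of_coupled hr (hEsub hq) x x'
      have h2 : ∀ (x x' : Ω → Fin k → ℝ) (r : ℕ),
          proj (state θ A x (r + (m + s)) (θ.symm^[r + (m + s)] ω)) =
            proj (state θ A x' (m + s) (θ.symm^[m + s] ω)) := fun x x' r =>
        proj_state_eq_of_coupled hr (hEsub hs) x x'
      change _ = proj (state θ A (fun _ => 0) (m + s) (θ.symm^[m + s] ω))
      rw [h1 x₀ x₀ r, ← h1 x₀ x₀ (m + s), ← h2 x₀ (fun _ => 0) (m + q), add_comm]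
    · exact absurd hω hs

theorem tendsto_measure_compl_of_monotone [IsFiniteMeasure P] {F : ℕ → Set Ω} (hF : Monotone F)
    (hFm : ∀ n, MeasurableSet (F n)) (h : ∀ᵐ ω ∂P, ∃ n, ω ∈ F n) :
    Tendsto (fun n => P.real (F n)ᶜ) atTop (𝓝 0) := by
  have h0 : P (⋂ n, (F n)ᶜ) = 0 := by
    rw [← Set.compl_iUnion]
    refine measure_mono_null (fun ω hω => ?_) (ae_iff.1 h)
    simpa using hω
  have := tendsto_measure_iInter_atTop (μ := P) (fun n => (hFm n).compl.nullMeasurableSet)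
    (fun n n' hn => Set.compl_subset_compl.2 (hF hn)) ⟨0, measure_ne_top _ _⟩
  rw [h0] at this
  exact (ENNReal.tendsto_toReal ENNReal.zero_ne_top).comp this

/-- Coupling inequality: by invariance `X n` and `X n ∘ θ⁻ⁿ` have the same law, and the latter
agrees with `Z` on `F n`, which bounds the difference uniformly in `B`. -/
theorem tendstoTV_of_coupling {E : Type*} [MeasurableSpace E] [IsFiniteMeasure P]
    (hθ : MeasurePreserving θ P P)
    {X : ℕ → Ω → E} {Z : Ω → E} {F : ℕ → Set Ω}
    (hF : Tendsto (fun n => P.real (F n)ᶜ) atTop (𝓝 0))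
    (h : ∀ᵐ ω ∂P, ∀ n, ω ∈ F n → X n (θ.symm^[n] ω) = Z ω) : TendstoTV P X Z := by
  have bound : ∀ n (B : {B : Set E // MeasurableSet B}),
      |P.real {ω | X n ω ∈ B.1} - P.real {ω | Z ω ∈ B.1}| ≤ P.real (F n)ᶜ := by
    intro n B
    have he : P.real {ω | X n ω ∈ B.1} = P.real {ω | X n (θ.symm^[n] ω) ∈ B.1} := by
      rw [Measure.real, Measure.real, ← measure_iterate_symm hθ {ω | X n ω ∈ B.1} n]
      rfl
    have mono : ∀ S T : Set Ω, (∀ᵐ ω ∂P, ω ∈ F n → ω ∈ S → ω ∈ T) →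
        P.real S ≤ P.real T + P.real (F n)ᶜ := by
      intro S T hST
      refine le_trans ?_ (measureReal_union_le T (F n)ᶜ)
      refine ENNReal.toReal_mono (measure_ne_top _ _) (measure_mono_ae ?_)
      filter_upwards [hST] with ω hω hS
      by_cases hωF : ω ∈ F n
      · exact .inl (hω hωF hS)
      · exact .inr hωF
    have h1 := mono {ω | X n (θ.symm^[n] ω) ∈ B.1} {ω | Z ω ∈ B.1} (by
      filter_upwards [h] with ω hω hF hS
      exact (hω n hF) ▸ hS)
    have h2 := mono {ω | Z ω ∈ B.1} {ω | X n (θ.symm^[n] ω) ∈ B.1} (by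
      filter_upwards [h] with ω hω hF hS
      exact (hω n hF).symm ▸ hS)
    rw [he, abs_le]
    constructor <;> linarith
  exact squeeze_zero (fun n => Real.iSup_nonneg fun B => abs_nonneg _)
    (fun n => Real.iSup_le (bound n) measureReal_nonneg) hF

/-- A stationary regime is the state started from itself at any time of the past. -/
theorem IsStationaryRegime.ae_eq_state (hθ : MeasurePreserving θ P P) {Z : Ω → Proj k}
    (hZ : IsStationaryRegime P θ A Z) :
    ∀ᵐ ω ∂P, ∀ n, proj (state θ A (fun ω => (Z ω).out) n (θ.symm^[n] ω)) = Z ω := by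
  have h : ∀ᵐ ω ∂P, ∀ n, ∀ u : Fin k → ℝ, proj u = Z (θ^[n] ω) →
      Z (θ (θ^[n] ω)) = proj (act (A (θ^[n] ω)) u) :=
    ae_all_iff.2 fun n => ((hθ.iterate n).quasiMeasurePreserving).ae hZ.2
  have h' : ∀ᵐ ω ∂P, ∀ n, proj (state θ A (fun ω => (Z ω).out) n ω) = Z (θ^[n] ω) := by
    filter_upwards [h] with ω hω n
    induction n with
    | zero => exact Quotient.out_eq _
    | succ n ih => rw [Function.iterate_succ_apply', hω n _ ih]; rfl
  have h'' : ∀ᵐ ω ∂P, ∀ q n, proj (state θ A (fun ω => (Z ω).out) n (θ.symm^[q] ω)) =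
      Z (θ^[n] (θ.symm^[q] ω)) :=
    ae_all_iff.2 fun q => (((hθ.symm θ).iterate q).quasiMeasurePreserving).ae h'
  filter_upwards [h''] with ω hω n
  rw [hω, iterate_symm_iterate]

end Stochastic

end MaxPlus

theorem mainTheorem6 {Ω : Type*} [MeasurableSpace Ω] (P : Measure Ω) [IsProbabilityMeasure P]
    (θ : Ω ≃ᵐ Ω) (hθ : Ergodic θ P) {k : ℕ} {L : Type*} [Countable L]
    (M : L → MaxPlus.Mat k) (hM : ∀ l, MaxPlus.Irreducible (M l))
    (A : Ω → MaxPlus.Mat k) (hA : Measurable A)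
    (hpos : ∀ l, 0 < P {ω | A ω = M l}) (hdisc : ∀ᵐ ω ∂P, ∃ l, A ω = M l)
    (hindep : iIndepFun (fun n => MaxPlus.matSeq θ A n) P)
    (hpattern : ∃ C, MaxPlus.IsPattern P θ M A C ∧ MaxPlus.IsScs1Cyc1 C) :
    ∃ Z : Ω → MaxPlus.Proj k, MaxPlus.IsStationaryRegime P θ A Z ∧
      (∀ Z', MaxPlus.IsStationaryRegime P θ A Z' → Z' =ᵐ[P] Z) ∧
      ∀ x₀ : Ω → Fin k → ℝ, Measurable x₀ →
        MaxPlus.StrongCoupling P θ (fun n ω => MaxPlus.proj (MaxPlus.state θ A x₀ n ω)) Z ∧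
        MaxPlus.TendstoTV P (fun n ω => MaxPlus.proj (MaxPlus.state θ A x₀ n ω)) Z := by
  have hmp := hθ.toMeasurePreserving
  have hrow : ∀ᵐ ω ∂P, ∀ i, ∃ j, A ω i j ≠ ⊥ := by
    filter_upwards [hdisc] with ω ⟨l, hl⟩
    exact hl ▸ (hM l).exists_ne_bot
  obtain ⟨m, E, hEsub, hE, hEpos⟩ :=
    MaxPlus.exists_coupled_event hmp hM hA hpos hindep hpattern
  obtain ⟨Z, hZ, F, hF, hFm, hFae, hFZ⟩ :=
    MaxPlus.exists_stationary_limit hθ hA hrow hEsub hE hEpos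
  refine ⟨Z, ⟨hZ, ?_⟩, fun Z' hZ' => ?_, fun x₀ _ => ⟨?_, ?_⟩⟩
  · filter_upwards [hrow, hFae, hFZ, hmp.quasiMeasurePreserving.ae hFae,
      hmp.quasiMeasurePreserving.ae hFZ] with ω hr ⟨n, hn⟩ hωZ ⟨n', hn'⟩ hθZ u hu
    -- Both values of `Z` are read off the same trajectory, started `n + n'` steps before time 0; `Z
    -- (θ ω)` takes one step more.
    have h1 := hωZ (n + n') (hF (by omega) hn) fun _ => 0
    have h2 := hθZ (n + n' + 1) (hF (by omega) hn') fun _ => 0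
    rw [← h2, Function.iterate_succ_apply, MeasurableEquiv.symm_apply_apply]
    simp only [MaxPlus.state, MaxPlus.matSeq]
    rw [MaxPlus.iterate_symm_iterate]
    exact MaxPlus.proj_act_congr hr (h1.trans hu.symm)
  -- `Z'` is the state started from its own representatives. These need not be measurable: off one
  -- null set, coupling holds for all initial conditions at once.
  · filter_upwards [hFae, hFZ, hZ'.ae_eq_state hmp] with ω ⟨n, hn⟩ hωZ hω
    rw [← hω n, hωZ n hn]
  · filter_upwards [hFae, hFZ] with ω ⟨n, hn⟩ hωZ
    exact ⟨n, fun l => hωZ (n + l) (hF (by omega) hn) x₀⟩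
  · refine MaxPlus.tendstoTV_of_coupling hmp
      (MaxPlus.tendsto_measure_compl_of_monotone hF hFm hFae) ?_
    filter_upwards [hFZ] with ω hω n hn
    exact hω n hn x₀
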